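/- Let $\mathcal I$ be a set of $m\ge 1$ items and $\mathcal N$ a set of $n$ agents. A valuation is a function $v_i:2^{\mathcal I}\to\mathbb R_{\ge 0}$ that is monotone with $v_i(\emptyset)=0$; it is unit-demand if $v_i(S)=\max_{j\in S}v_i(\{j\})$ for every nonempty $S\subseteq\mathcal I$. For a profile $v=(v_1,\dots,v_n)$ let $SW_v(\mathcal N',\mathcal I')$ be the maximum of $\sum_{i\in\mathcal N'}v_i(A_i)$ over all allocations of pairwise disjoint bundles $A_i\subseteq\mathcal I'$. VCG with copies, with parameter $r\in\mathbb N$, is the following randomized mechanism for unit-demand agents. Draw $\ell$ uniformly from $\{0,\dots,r\}$. Replace every item by $2^\ell$ copies, $\mathcal I'=\mathcal I\times[2^\ell]$, with valuations $v_i'(S)=v_i(\{j:\exists k,\ (j,k)\in S\})$. Run VCG on this instance: choose (by an arbitrary fixed rule) a welfare-maximizing allocation $A'$ with $v_i'(A_i'\setminus\{x\})<v_i'(A_i')$ for all $i$ and $x\in A_i'$, and set $p_i'=SW_{v'}(\mathcal N\setminus\{i\},\mathcal I')-SW_{v'}(\mathcal N\setminus\{i\},\mathcal I'\setminus A_i')$.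 Choose for each item independently a uniformly random one of its $2^\ell$ copies; if the chosen copy is in $A_i'$, agent $i$ gets the item and pays $p_i'$. Agents who get no item pay $0$. There is an absolute constant $C\ge 1$ such that for all $n$ and all $m\ge 1$ the mechanism $\mathcal M$ given by VCG with copies with $$r=\Big\lceil \log_2\Big(\tfrac{2e}{e-1}\max\{1,\tfrac nm\}\Big)\Big\rceil ,$$ for any rule choosing the VCG allocations, has the following properties. 1. On every profile of unit-demand valuations, $\mathcal M$ always outputs a valid allocation of $\mathcal I$ (disjoint bundles) and nonnegative payments, it is truthful in expectation (no agent can increase the expectation of $v_i(A_i)-p_i$ by reporting another unit-demand valuation), and it is ex-post individually rational ($v_i(A_i)-p_i\ge 0$ for every $i$ and every outcome of positive probability). 2. Let $v_1,\dots,v_n$ be independent random unit-demand valuations, $v_i\sim\mathcal F_i$, that satisfy the uniform highest value assumption: for each agent $i$ there is a (possibly randomized) way of choosing, given $v_i$, one item of largest value $v_i(\{j\})$ such that every item is chosen with probability $1/m$. Then $$\mathbb E_{v}\Big[\mathbb E_{(A,p)\sim\mathcal M(v)}\Big[\sum_{i\in\mathcal N}\big(v_i(A_i)-p_i\big)\Big]\Big]\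 \ge\ \frac{\mathbb E_{v}\big[SW_v(\mathcal N,\mathcal I)\big]}{C\cdot\max\{1,\log\frac nm\}}.$$ (Both expectations over $v$ are of nonnegative quantities and are taken in $[0,\infty]$.) -/

import Mathlib

open MeasureTheory ProbabilityTheory
open scoped ENNReal

noncomputable section

namespace Auction

/-! ### Valuations, allocations, social welfare -/

section Model

variable {N I J : Type*}

/-- Set functions on bundles of items.  `N` is the set of agents, `I` the set of items. -/
abbrev Valuation (I : Type*) := Finset I → ℝ

/-- One set function per agent. -/
abbrev Profile (N I : Type*) := N → Valuation I

/-- One bundle per agent (disjointness is imposed by `IsAllocation`). -/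
abbrev Bundles (N I : Type*) := N → Finset I

/-- A valuation function is nonnegative, normalized and monotone. -/
structure IsValuation (v : Valuation I) : Prop where
  nonneg : ∀ S, 0 ≤ v S
  normalized : v ∅ = 0
  mono : ∀ S T, S ⊆ T → v S ≤ v T

/-- Unit-demand valuation: the value of a nonempty bundle is the largest value of an item in it. -/
structure IsUnitDemand (v : Valuation I) : Prop extends IsValuation v where
  unit_demand : ∀ (S : Finset I) (hS : S.Nonempty), v S = S.sup' hS (fun j => v {j})

/-- `A` gives pairwise disjoint bundles of items of `S` to the agents; items may be left over. -/
structure IsAllocation (S : Finset I) (A : Bundles N I) : Prop where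
  subset : ∀ i, A i ⊆ S
  disjoint : ∀ i k, i ≠ k → Disjoint (A i) (A k)

/-- The optimal social welfare of the agents in `T` from the items in `S`
(a maximum, see `isGreatest_optWelfare`). -/
def optWelfare (v : Profile N I) (T : Finset N) (S : Finset I) : ℝ :=
  sSup {w : ℝ | ∃ A : Bundles N I, IsAllocation S A ∧ w = ∑ i ∈ T, v i (A i)}

theorem isGreatest_optWelfare [Finite N] [Finite I]
    (v : Profile N I) (T : Finset N) (S : Finset I) :
    IsGreatest {w : ℝ | ∃ A : Bundles N I, IsAllocation S A ∧ w = ∑ i ∈ T, v i (A i)}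
      (optWelfare v T S) := by
  have hfin : {w : ℝ | ∃ A : Bundles N I, IsAllocation S A ∧ w = ∑ i ∈ T, v i (A i)}.Finite := by
    refine (Set.finite_range (fun A : Bundles N I => ∑ i ∈ T, v i (A i))).subset ?_
    rintro w ⟨A, -, rfl⟩
    exact ⟨A, rfl⟩
  have hne : {w : ℝ | ∃ A : Bundles N I, IsAllocation S A ∧ w = ∑ i ∈ T, v i (A i)}.Nonempty :=
    ⟨_, fun _ => ∅, ⟨fun _ => Finset.empty_subset _, fun _ _ _ => Finset.disjoint_empty_left _⟩,
      rfl⟩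
  exact ⟨hne.csSup_mem hfin, fun w hw => le_csSup hfin.bddAbove hw⟩

/-! ### The VCG mechanism -/

/-- A welfare-maximizing allocation of all items in which every allocated item strictly
contributes to the value of the agent who receives it. -/
structure IsVCGAllocation [Fintype N] [Fintype J] [DecidableEq J]
    (v : Profile N J) (A : Bundles N J) : Prop where
  isAllocation : IsAllocation Finset.univ A
  optimal : ∑ i, v i (A i) = optWelfare v Finset.univ Finset.univ
  nonredundant : ∀ i, ∀ j ∈ A i, v i ((A i).erase j) < v i (A i)

/-- An implementation of VCG for the agents `N` and the items `J`: an arbitrary selection of a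
non-redundant welfare-maximizing allocation for every profile of valuations. -/
structure VCGRule (N J : Type*) [Fintype N] [Fintype J] [DecidableEq J] where
  allocate : Profile N J → Bundles N J
  spec : ∀ v : Profile N J, (∀ i, IsValuation (v i)) → IsVCGAllocation v (allocate v)

/-- The VCG payment of agent `i` when the allocation is `A`: the externality of `i` on the other
agents. -/
def vcgPayment [Fintype N] [DecidableEq N] [Fintype J] [DecidableEq J]
    (v : Profile N J) (A : Bundles N J) (i : N) : ℝ :=
  optWelfare v (Finset.univ.erase i) Finset.univ -
    optWelfare v (Finset.univ.erase i) (Finset.univ \ A i)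

theorem exists_isVCGAllocation [Fintype N] [Fintype J] [DecidableEq J]
    (v : Profile N J) (hv : ∀ i, IsValuation (v i)) : ∃ A, IsVCGAllocation v A := by
  classical
  have hg := isGreatest_optWelfare v Finset.univ Finset.univ
  let P : Set (Bundles N J) := {A | IsAllocation Finset.univ A ∧
    ∑ i, v i (A i) = optWelfare v Finset.univ Finset.univ}
  have hP : P.Nonempty := by
    obtain ⟨A, hA, hw⟩ := hg.1
    exact ⟨A, hA, hw.symm⟩
  obtain ⟨A, hA, hmin⟩ :=
    Set.exists_min_image P (fun A => ∑ i, (A i).card) (Set.toFinite P) hP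
  refine ⟨A, hA.1, hA.2, fun i j hj => ?_⟩
  by_contra hlt
  have heq : v i ((A i).erase j) = v i (A i) :=
    le_antisymm ((hv i).mono _ _ (Finset.erase_subset _ _)) (not_lt.mp hlt)
  let B : Bundles N J := Function.update A i ((A i).erase j)
  have hBsub : ∀ k, B k ⊆ A k := by
    intro k
    by_cases hk : k = i
    · subst hk; simp [B, Finset.erase_subset]
    · simp [B, hk]
  have hBv : ∀ k, v k (B k) = v k (A k) := by
    intro k
    by_cases hk : k = i
    · subst hk; simpa [B] using heq
    · simp [B, hk]
  have hB : B ∈ P :=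
    ⟨⟨fun k => Finset.subset_univ _, fun k l hkl =>
      (hA.1.disjoint k l hkl).mono (hBsub k) (hBsub l)⟩, by simp only [hBv]; exact hA.2⟩
  have hlt2 : ∑ k, (B k).card < ∑ k, (A k).card := by
    refine Finset.sum_lt_sum (fun k _ => Finset.card_le_card (hBsub k)) ⟨i, Finset.mem_univ _, ?_⟩
    simpa [B] using Finset.card_erase_lt_of_mem hj
  exact absurd (hmin B hB) (not_le.mpr hlt2)

instance [Fintype N] [Fintype J] [DecidableEq J] : Nonempty (VCGRule N J) := by
  classical
  exact ⟨⟨fun v => if h : ∃ A, IsVCGAllocation v A then h.choose else fun _ => ∅, fun v hv => by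
    have h := exists_isVCGAllocation v hv
    simpa only [dif_pos h] using h.choose_spec⟩⟩

/-! ### Randomized mechanisms -/

/-- An outcome: a bundle and a payment for every agent. -/
abbrev Outcome (N I : Type*) := Bundles N I × (N → ℝ)

/-- A randomized direct-revelation mechanism. -/
abbrev Mechanism (N I : Type*) := Profile N I → PMF (Outcome N I)

/-- Expectation of `f` under `P` (used for `P` of finite support). -/
def expect {α : Type*} (P : PMF α) (f : α → ℝ) : ℝ := ∑' a, (P a).toReal * f a

/-- The utility of an agent with valuation `v` in the role of agent `i`. -/
def utility (v : Valuation I) (i : N) (o : Outcome N I) : ℝ := v (o.1 i) - o.2 i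

/-- The residual surplus of an outcome. -/
def residualSurplus [Fintype N] (v : Profile N I) (o : Outcome N I) : ℝ :=
  ∑ i, (v i (o.1 i) - o.2 i)

/-- On profiles of valuations in the class `D`, the mechanism always outputs an allocation of the
items and nonnegative payments, and uses finitely many outcomes. -/
def IsFeasible [Fintype I] (D : Valuation I → Prop) (M : Mechanism N I) : Prop :=
  ∀ v : Profile N I, (∀ i, D (v i)) →
    (M v).support.Finite ∧
    ∀ o ∈ (M v).support, IsAllocation Finset.univ o.1 ∧ ∀ i, 0 ≤ o.2 i

/-- Truthfulness in expectation for agents with valuations in the class `D`. -/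
def IsTruthfulInExpectation [DecidableEq N] (D : Valuation I → Prop) (M : Mechanism N I) : Prop :=
  ∀ v : Profile N I, (∀ i, D (v i)) → ∀ (i : N) (b : Valuation I), D b →
    expect (M (Function.update v i b)) (utility (v i) i) ≤ expect (M v) (utility (v i) i)

/-- Ex-post individual rationality for agents with valuations in the class `D`. -/
def IsExPostIR (D : Valuation I → Prop) (M : Mechanism N I) : Prop :=
  ∀ v : Profile N I, (∀ i, D (v i)) → ∀ o ∈ (M v).support, ∀ i, 0 ≤ utility (v i) i o

/-! ### VCG with copies -/

/-- The valuation on the items with `k` copies each: several copies of an item count once. -/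
def copiesValuation [DecidableEq I] (k : ℕ) (v : Valuation I) : Valuation (I × Fin k) :=
  fun S => v (S.image Prod.fst)

/-- The rounding for unit-demand agents: given the VCG allocation `A` and the payments `p` of the
instance with `k` copies, and a chosen copy `c j` of each item `j`, the item `j` goes to the agent
(if any) who holds its copy `c j`, and exactly the agents who receive an item are charged. -/
def roundOutcome [Fintype I] [DecidableEq I] {k : ℕ} (A : Bundles N (I × Fin k)) (p : N → ℝ)
    (c : I → Fin k) : Outcome N I :=
  let B : Bundles N I := fun i => Finset.univ.filter (fun j => (j, c j) ∈ A i)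
  (B, fun i => if (B i).Nonempty then p i else 0)

/-- VCG with copies, with parameter `r` and the rounding for unit-demand agents (for which each
agent is served with probability `1 / 2 ^ ℓ`): draw `ℓ` uniformly from `{0, …, r}`, run VCG on the
instance with `2 ^ ℓ` copies of every item, choose for every item independently a uniform copy
(that is, a uniform function from items to copies), and round. -/
def vcgWithCopies [Fintype N] [DecidableEq N] [Fintype I] [DecidableEq I]
    (R : (ℓ : ℕ) → VCGRule N (I × Fin (2 ^ ℓ))) (r : ℕ) : Mechanism N I := fun v =>
  (PMF.uniformOfFintype (Fin (r + 1))).bind fun ℓ =>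
    let v' : Profile N (I × Fin (2 ^ (ℓ : ℕ))) := fun i => copiesValuation (2 ^ (ℓ : ℕ)) (v i)
    let A' := (R ℓ).allocate v'
    (PMF.uniformOfFintype (I → Fin (2 ^ (ℓ : ℕ)))).map
      (roundOutcome A' (vcgPayment v' A'))

/-! ### The Bayesian setting -/

/-- The uniform highest value assumption for the law `F` of one agent's valuation: for some
(possibly randomized) way `τ` of choosing one favorite item among those of highest value, every
item is the favorite one with the same probability. -/
def UniformHighestValue [Fintype I] [MeasurableSpace I] (F : Measure (Valuation I)) : Prop :=
  ∃ τ : Kernel (Valuation I) I, IsMarkovKernel τ ∧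
    (∀ᵐ v ∂F, ∀ᵐ j ∂(τ v), ∀ j', v {j'} ≤ v {j}) ∧
    ∀ j, ∫⁻ v, τ v {j} ∂F = (Fintype.card I : ℝ≥0∞)⁻¹

/-- The mechanism guarantees an `α`-approximation of the expected optimal welfare as residual
surplus, when the valuations are independent and agent `i`'s has law `F i`.  The expectations over
the valuations are taken in `[0, ∞]`; both integrands are nonnegative for an ex-post individually
rational mechanism. -/
def GuaranteesApprox [Fintype N] [Fintype I] (M : Mechanism N I)
    (F : N → Measure (Valuation I)) (α : ℝ) : Prop :=
  (∫⁻ v, ENNReal.ofReal (optWelfare v Finset.univ Finset.univ) ∂(Measure.pi F)) / ENNReal.ofReal α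
    ≤ ∫⁻ v, ENNReal.ofReal (expect (M v) (residualSurplus v)) ∂(Measure.pi F)

/-- `⌈log₂ ((2e / (e - 1)) * max {1, n / m})⌉`. -/
def copiesParameter (n m : ℕ) : ℕ :=
  ⌈Real.logb 2 (2 * Real.exp 1 / (Real.exp 1 - 1) * max 1 ((n : ℝ) / m))⌉₊

end Model

end Auction

end

/-!
With `2 ^ ℓ` copies, unit-demand agents win at most one copy each, and rounding serves each winner
with probability `1 / 2 ^ ℓ` at her VCG price. Expected utilities are therefore VCG utilities scaled
by `1 / 2 ^ ℓ`, which makes truthfulness a property of VCG, and the utility of a truthful agent `i`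
is her contribution `W ℓ - W ℓ (without i)` to the optimal welfare `W ℓ` with `2 ^ ℓ` copies.

For the residual surplus, the crucial inequality (`two_mul_add_sum_le`) is
`2 * W ℓ + ∑ i, W (ℓ + 1) (without i) ≤ (n + 1) * W (ℓ + 1)`, where `n` is the number of agents.
The left side is the welfare of a family of matchings (two optimal matchings for `2 ^ ℓ` copies on
disjoint sets of copies, and one for each `i`) in which every agent and every copy is matched at
most `n + 1` times. Divided by `n + 1`, it is a fractional assignment, so by Birkhoff's theorem it
is no better than the optimum (`sum_mul_le_optWelfare`). Hence the surplus at `ℓ + 1` is at least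
`2 * W ℓ - W (ℓ + 1)`; weighted with `1 / 2 ^ (ℓ + 1)` these bounds telescope to
`W 0 - W r / 2 ^ r` (`sub_le_expect_residualSurplus`).

It remains to see that `W r / 2 ^ r` is at most half of `W 0` in expectation. `W r` is at most the
sum of the agents' highest values. Conversely, give every item to the agent who values it most among
those who have it as their favourite. Under the uniform highest value assumption, an item is the
favourite of each of the agents with probability `1 / m`, independently, and a correlation gap
inequality (`mul_sum_lintegral_le_lintegral_sup`), proved by integrating
`1 - ∏ (1 - p i) ≥ 1 - exp (-∑ p i)` over all value thresholds, shows that this recovers in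
expectation a fraction `(1 - 1 / e) / max 1 (n / m)` of the sum of the highest values. The parameter
`r` is chosen so that `2 ^ r` is at least twice the inverse of this fraction. The subtraction needs
finite expectations; if some agent's highest value has infinite expectation, then so has the
utility that she alone obtains from the instance without copies
(`lintegral_sub_sum_erase_eq_top`).
-/

namespace Auction

/-! ### Optimal welfare -/

section Welfare

variable {N J : Type*}

theorem IsAllocation.sum_le_optWelfare [Finite N] [Finite J] {S : Finset J} {A : Bundles N J}
    (hA : IsAllocation S A) (v : Profile N J) (T : Finset N) :
    ∑ i ∈ T, v i (A i) ≤ optWelfare v T S :=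
  (isGreatest_optWelfare v T S).2 ⟨A, hA, rfl⟩

theorem exists_sum_eq_optWelfare [Finite N] [Finite J] (v : Profile N J) (T : Finset N)
    (S : Finset J) : ∃ A, IsAllocation S A ∧ ∑ i ∈ T, v i (A i) = optWelfare v T S :=
  let ⟨A, hA, h⟩ := (isGreatest_optWelfare v T S).1
  ⟨A, hA, h.symm⟩

theorem optWelfare_le [Finite N] [Finite J] {v : Profile N J} {T : Finset N} {S : Finset J} {t : ℝ}
    (h : ∀ A, IsAllocation S A → ∑ i ∈ T, v i (A i) ≤ t) : optWelfare v T S ≤ t := by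
  obtain ⟨A, hA, hw⟩ := exists_sum_eq_optWelfare v T S
  exact hw ▸ h A hA

theorem optWelfare_mono_items [Finite N] [Finite J] (v : Profile N J) (T : Finset N)
    {S S' : Finset J} (h : S ⊆ S') : optWelfare v T S ≤ optWelfare v T S' :=
  optWelfare_le fun _ hA => IsAllocation.sum_le_optWelfare
    ⟨fun i => (hA.subset i).trans h, hA.disjoint⟩ v T

theorem optWelfare_congr {v v' : Profile N J} {T : Finset N} (S : Finset J)
    (h : ∀ i ∈ T, v i = v' i) : optWelfare v T S = optWelfare v' T S := by
  have (A : Bundles N J) : ∑ i ∈ T, v i (A i) = ∑ i ∈ T, v' i (A i) :=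
    Finset.sum_congr rfl fun i hi => by rw [h i hi]
  simp only [optWelfare, this]

theorem optWelfare_nonneg [Finite N] [Finite J] {v : Profile N J} (hv : ∀ i, IsValuation (v i))
    (T : Finset N) (S : Finset J) : 0 ≤ optWelfare v T S := by
  obtain ⟨A, -, hw⟩ := exists_sum_eq_optWelfare v T S
  exact hw ▸ Finset.sum_nonneg fun i _ => (hv i).nonneg _

/-- Reserving a bundle for one agent and allocating the rest optimally to the others is one way
of allocating all items. -/
theorem add_optWelfare_le [Fintype N] [DecidableEq N] [Fintype J] [DecidableEq J]
    (v : Profile N J) (i : N) (S : Finset J) :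
    v i S + optWelfare v (Finset.univ.erase i) (Finset.univ \ S) ≤
      optWelfare v Finset.univ Finset.univ := by
  obtain ⟨A, hA, hw⟩ := exists_sum_eq_optWelfare v (Finset.univ.erase i) (Finset.univ \ S)
  have hB : IsAllocation Finset.univ (Function.update A i S) := by
    refine ⟨fun _ => Finset.subset_univ _, fun k l hkl => ?_⟩
    have hS (k : N) : Disjoint (A k) S := Finset.disjoint_of_subset_left (hA.subset k)
      Finset.sdiff_disjoint
    rcases eq_or_ne k i with rfl | hk
    · simpa [Function.update_of_ne hkl.symm] using (hS l).symm
    · rcases eq_or_ne l i with rfl | hl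
      · simpa [Function.update_of_ne hk] using hS k
      · simpa [Function.update_of_ne hk, Function.update_of_ne hl] using hA.disjoint k l hkl
  refine le_trans (le_of_eq ?_) (hB.sum_le_optWelfare v Finset.univ)
  rw [← Finset.add_sum_erase _ _ (Finset.mem_univ i), ← hw]
  congr 1
  · simp
  · exact Finset.sum_congr rfl fun k hk => by
      rw [Function.update_of_ne (Finset.ne_of_mem_erase hk)]

theorem IsVCGAllocation.add_optWelfare_eq [Fintype N] [DecidableEq N] [Fintype J] [DecidableEq J]
    {v : Profile N J} {A : Bundles N J} (hA : IsVCGAllocation v A) (i : N) :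
    v i (A i) + optWelfare v (Finset.univ.erase i) (Finset.univ \ A i) =
      optWelfare v Finset.univ Finset.univ := by
  refine (add_optWelfare_le v i (A i)).antisymm ?_
  rw [← hA.optimal, ← Finset.add_sum_erase _ _ (Finset.mem_univ i)]
  gcongr
  let B : Bundles N J := Function.update A i ∅
  have hB : IsAllocation (Finset.univ \ A i) B := by
    refine ⟨fun k => ?_, fun k l hkl => ?_⟩
    · rcases eq_or_ne k i with rfl | hk
      · simp [B]
      · simpa [B, hk, Finset.subset_sdiff] using hA.isAllocation.disjoint k i hk
    · have hsub (k : N) : B k ⊆ A k := by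
        rcases eq_or_ne k i with rfl | hk
        · simp [B]
        · simp [B, hk]
      exact (hA.isAllocation.disjoint k l hkl).mono (hsub k) (hsub l)
  refine le_trans (le_of_eq ?_) (hB.sum_le_optWelfare v _)
  exact Finset.sum_congr rfl fun k hk => by
    simp [B, Function.update_of_ne (Finset.ne_of_mem_erase hk)]

theorem optWelfare_le_sum_univ [Fintype N] [Fintype J] {v : Profile N J}
    (hv : ∀ i, IsValuation (v i)) (T : Finset N) (S : Finset J) :
    optWelfare v T S ≤ ∑ i ∈ T, v i Finset.univ :=
  optWelfare_le fun _ _ => Finset.sum_le_sum fun i _ => (hv i).mono _ _ (Finset.subset_univ _)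

theorem optWelfare_erase_le [Fintype N] [DecidableEq N] [Finite J] {v : Profile N J}
    (hv : ∀ i, IsValuation (v i)) (i : N) (S : Finset J) :
    optWelfare v (Finset.univ.erase i) S ≤ optWelfare v Finset.univ S :=
  optWelfare_le fun _ hA => (Finset.sum_le_sum_of_subset_of_nonneg (Finset.erase_subset _ _)
    fun k _ _ => (hv k).nonneg _).trans (hA.sum_le_optWelfare v _)

end Welfare

/-! ### Unit-demand agents and matchings -/

section UnitDemand

variable {N I J : Type*}

theorem IsUnitDemand.exists_mem_eq {v : Valuation J} (hv : IsUnitDemand v) {S : Finset J}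
    (hS : S.Nonempty) : ∃ x ∈ S, v {x} = v S := by
  obtain ⟨x, hx, h⟩ := S.exists_mem_eq_sup' hS fun j => v {j}
  exact ⟨x, hx, by rw [hv.unit_demand S hS, h]⟩

theorem IsUnitDemand.exists_subset_card_le_one {v : Valuation J} (hv : IsUnitDemand v)
    (S : Finset J) : ∃ B ⊆ S, B.card ≤ 1 ∧ v B = v S := by
  rcases S.eq_empty_or_nonempty with rfl | hS
  · exact ⟨∅, subset_rfl, by simp, rfl⟩
  · obtain ⟨x, hx, h⟩ := hv.exists_mem_eq hS
    exact ⟨{x}, by simpa using hx, by simp, h⟩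

theorem IsUnitDemand.card_le_one [DecidableEq J] {v : Valuation J} (hv : IsUnitDemand v)
    {S : Finset J} (h : ∀ j ∈ S, v (S.erase j) < v S) : S.card ≤ 1 := by
  by_contra! hS
  obtain ⟨x, hx, hxS⟩ := hv.exists_mem_eq (S := S) (Finset.card_pos.mp (by omega))
  obtain ⟨y, hy, hyx⟩ := Finset.exists_mem_ne hS x
  have := hv.mono {x} (S.erase y) (by simp [hx, hyx.symm])
  linarith [h y hy]

theorem IsUnitDemand.eq_sum {v : Valuation J} (hv : IsUnitDemand v) {S : Finset J}
    (hS : S.card ≤ 1) : v S = ∑ x ∈ S, v {x} := by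
  rcases S.eq_empty_or_nonempty with rfl | hne
  · simpa using hv.normalized
  · obtain ⟨x, rfl⟩ := Finset.card_eq_one.mp (hS.antisymm hne.card_pos)
    simp

theorem IsValuation.copies [DecidableEq I] {v : Valuation I} (hv : IsValuation v) (k : ℕ) :
    IsValuation (copiesValuation k v) :=
  ⟨fun _ => hv.nonneg _, by simpa [copiesValuation] using hv.normalized,
    fun _ _ h => hv.mono _ _ (Finset.image_subset_image h)⟩

theorem IsUnitDemand.copies [DecidableEq I] {v : Valuation I} (hv : IsUnitDemand v) (k : ℕ) :
    IsUnitDemand (copiesValuation k v) where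
  toIsValuation := hv.toIsValuation.copies k
  unit_demand S hS := by
    rw [copiesValuation, hv.unit_demand _ (hS.image _), Finset.sup'_image]
    rfl

theorem IsAllocation.card_filter_mem_le_one [Fintype N] [DecidableEq J] {S : Finset J}
    {A : Bundles N J} (hA : IsAllocation S A) (x : J) :
    (Finset.univ.filter fun i => x ∈ A i).card ≤ 1 := by
  refine Finset.card_le_one.mpr fun i hi k hk => ?_
  by_contra hik
  simp only [Finset.mem_filter, Finset.mem_univ, true_and] at hi hk
  exact Finset.disjoint_left.mp (hA.disjoint i k hik) hi hk

/-- The optimal welfare of unit-demand agents is attained by a matching. -/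
theorem exists_matching_sum_eq_optWelfare [Fintype N] [DecidableEq N] [Finite J] {v : Profile N J}
    (hv : ∀ i, IsUnitDemand (v i)) (T : Finset N) (S : Finset J) :
    ∃ A, IsAllocation S A ∧ (∀ i, (A i).card ≤ 1) ∧ (∀ i ∉ T, A i = ∅) ∧
      ∑ i, v i (A i) = optWelfare v T S := by
  obtain ⟨A, hA, hw⟩ := exists_sum_eq_optWelfare v T S
  choose B hBA hB hBv using fun i => (hv i).exists_subset_card_le_one (A i)
  have hsub (i : N) : (if i ∈ T then B i else ∅) ⊆ A i := by split_ifs <;> simp [hBA]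
  refine ⟨fun i => if i ∈ T then B i else ∅, ⟨fun i => (hsub i).trans (hA.subset i),
    fun i k hik => (hA.disjoint i k hik).mono (hsub i) (hsub k)⟩, fun i => ?_,
    fun i hi => if_neg hi, ?_⟩
  · dsimp only
    split_ifs <;> simp [hB]
  · rw [← hw, ← Finset.sum_subset (Finset.subset_univ T)]
    · exact Finset.sum_congr rfl fun i hi => by simp only [if_pos hi, hBv]
    · exact fun i _ hi => by simp only [if_neg hi, (hv i).normalized]

/-- Integrality of the assignment problem: fractional assignments are no better than allocations.
A doubly substochastic matrix is a block of a doubly stochastic one, which is a convex combination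
of permutation matrices. -/
theorem sum_mul_le_optWelfare [Fintype N] [Fintype J] {v : Profile N J}
    (hv : ∀ i, IsUnitDemand (v i)) (M : N → J → ℝ) (hM : ∀ i x, 0 ≤ M i x)
    (hrow : ∀ i, ∑ x, M i x ≤ 1) (hcol : ∀ x, ∑ i, M i x ≤ 1) :
    ∑ i, ∑ x, M i x * v i {x} ≤ optWelfare v Finset.univ Finset.univ := by
  classical
  -- the slack of the rows and columns of `M` goes to the diagonal blocks
  let P : Matrix (N ⊕ J) (N ⊕ J) ℝ := Matrix.fromBlocks
    (Matrix.diagonal fun i => 1 - ∑ x, M i x) (Matrix.of M)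
    (Matrix.of M).transpose (Matrix.diagonal fun x => 1 - ∑ i, M i x)
  have hP : P ∈ doublyStochastic ℝ (N ⊕ J) := by
    rw [mem_doublyStochastic_iff_sum]
    refine ⟨?_, ?_, ?_⟩
    · rintro (i | x) (k | y)
      · simp only [P, Matrix.fromBlocks_apply₁₁, Matrix.diagonal_apply]
        split_ifs <;> linarith [hrow i]
      · exact hM i y
      · exact hM k x
      · simp only [P, Matrix.fromBlocks_apply₂₂, Matrix.diagonal_apply]
        split_ifs <;> linarith [hcol x]
    · rintro (i | x) <;> simp [P, Matrix.diagonal_apply]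
    · rintro (i | x) <;> simp [P, Matrix.diagonal_apply]
  obtain ⟨w, hw0, hw1, hwP⟩ := exists_eq_sum_perm_of_mem_doublyStochastic hP
  have hMw (i : N) (x : J) :
      M i x = ∑ σ : Equiv.Perm (N ⊕ J), w σ * if σ (Sum.inl i) = Sum.inr x then 1 else 0 := by
    have := congrFun (congrFun hwP (Sum.inl i)) (Sum.inr x)
    rw [Matrix.sum_apply] at this
    simpa [P, Equiv.Perm.permMatrix, PEquiv.toMatrix_apply, eq_comm] using this.symm
  have hσ (σ : Equiv.Perm (N ⊕ J)) :
      ∑ i, ∑ x, (if σ (Sum.inl i) = Sum.inr x then 1 else 0) * v i {x} ≤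
        optWelfare v Finset.univ Finset.univ := by
    let A : Bundles N J := fun i => Finset.univ.filter fun x => σ (Sum.inl i) = Sum.inr x
    have hA : IsAllocation Finset.univ A := by
      refine ⟨fun i => Finset.subset_univ _, fun i k hik => Finset.disjoint_left.mpr ?_⟩
      intro x hi hk
      simp only [A, Finset.mem_filter, Finset.mem_univ, true_and] at hi hk
      exact hik (Sum.inl_injective (σ.injective (hi.trans hk.symm)))
    refine le_trans (le_of_eq (Finset.sum_congr rfl fun i _ => ?_))
      (hA.sum_le_optWelfare v Finset.univ)
    rw [(hv i).eq_sum]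
    · simp [A, Finset.sum_filter]
    · refine Finset.card_le_one.mpr fun x hx y hy => ?_
      simp only [A, Finset.mem_filter, Finset.mem_univ, true_and] at hx hy
      exact Sum.inr_injective (hx.symm.trans hy)
  calc ∑ i, ∑ x, M i x * v i {x}
      = ∑ σ, w σ * ∑ i, ∑ x, (if σ (Sum.inl i) = Sum.inr x then 1 else 0) * v i {x} := by
        simp only [hMw, Finset.sum_mul, Finset.mul_sum, mul_assoc]
        exact (Finset.sum_congr rfl fun i _ => Finset.sum_comm).trans Finset.sum_comm
    _ ≤ ∑ σ, w σ * optWelfare v Finset.univ Finset.univ :=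
        Finset.sum_le_sum fun σ _ => mul_le_mul_of_nonneg_left (hσ σ) (hw0 σ)
    _ = optWelfare v Finset.univ Finset.univ := by rw [← Finset.sum_mul, hw1, one_mul]

/-- A family of matchings in which every agent and every item is matched at most `d` times has
total welfare at most `d` times the optimum: its average is a fractional assignment. -/
theorem sum_sum_le_mul_optWelfare {K : Type*} [Fintype K] [Fintype N] [Fintype J] [DecidableEq J]
    {v : Profile N J} (hv : ∀ i, IsUnitDemand (v i)) (B : K → Bundles N J)
    (hB : ∀ k i, (B k i).card ≤ 1) {d : ℕ} (hd : 0 < d) (hrow : ∀ i, ∑ k, (B k i).card ≤ d)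
    (hcol : ∀ x, ∑ k, (Finset.univ.filter fun i => x ∈ B k i).card ≤ d) :
    ∑ k, ∑ i, v i (B k i) ≤ d * optWelfare v Finset.univ Finset.univ := by
  have hd' : (0 : ℝ) < d := by exact_mod_cast hd
  have key := sum_mul_le_optWelfare hv
    (fun i x => (∑ k, if x ∈ B k i then (1 : ℝ) else 0) / d) (fun i x => by positivity)
    (fun i => by
      rw [← Finset.sum_div, div_le_one hd', Finset.sum_comm]
      simpa using (Nat.cast_le (α := ℝ)).mpr (hrow i))
    (fun x => by
      rw [← Finset.sum_div, div_le_one hd', Finset.sum_comm]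
      simpa using (Nat.cast_le (α := ℝ)).mpr (hcol x))
  rw [← div_le_iff₀' hd']
  refine le_trans (le_of_eq ?_) key
  rw [Finset.sum_comm, Finset.sum_div]
  refine Finset.sum_congr rfl fun i _ => ?_
  simp only [div_mul_eq_mul_div, ← Finset.sum_div, Finset.sum_mul]
  rw [Finset.sum_comm]
  congr 1
  refine Finset.sum_congr rfl fun k _ => ?_
  rw [(hv i).eq_sum (hB k i)]
  simp

/-- Doubling the supply: two optimal matchings of the instance with `k` copies, placed on disjoint
halves of the `k'` copies, and the optimal matchings of the `n` subinstances without one agent,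
together match every agent and every item at most `n + 1` times. -/
theorem two_mul_add_sum_le [Fintype N] [DecidableEq N] [Fintype I] [DecidableEq I]
    {v : Profile N I} (hv : ∀ i, IsUnitDemand (v i)) {k k' : ℕ} (h : 2 * k ≤ k') :
    2 * optWelfare (fun i => copiesValuation k (v i)) Finset.univ Finset.univ +
        ∑ i, optWelfare (fun i => copiesValuation k' (v i)) (Finset.univ.erase i) Finset.univ ≤
      (Fintype.card N + 1) *
        optWelfare (fun i => copiesValuation k' (v i)) Finset.univ Finset.univ := by
  obtain ⟨C, hC, hC1, -, hCw⟩ :=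
    exists_matching_sum_eq_optWelfare (fun i => (hv i).copies k) Finset.univ Finset.univ
  choose D hD hD1 hD0 hDw using fun i => exists_matching_sum_eq_optWelfare
    (fun i => (hv i).copies k') (Finset.univ.erase i) Finset.univ
  -- `e b` places `k` copies on the first or on the second `k` of the `k'` copies
  let e : Bool → I × Fin k → I × Fin k' := fun b x => (x.1, ⟨(if b then k else 0) + x.2, by
    have := x.2.2
    split_ifs <;> omega⟩)
  have he (b : Bool) : Function.Injective (e b) := by
    rintro ⟨x, a⟩ ⟨y, c⟩ hxy
    simp only [e, Prod.mk.injEq, Fin.mk.injEq] at hxy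
    exact Prod.ext hxy.1 (Fin.ext (by simpa using hxy.2))
  let B : Bool ⊕ N → Bundles N (I × Fin k') :=
    Sum.elim (fun b i => (C i).image (e b)) D
  have hB1 : ∀ s i, (B s i).card ≤ 1 := by
    rintro (b | l) i
    · exact Finset.card_image_le.trans (hC1 i)
    · exact hD1 l i
  have key := sum_sum_le_mul_optWelfare (fun i => (hv i).copies k') B hB1
    (d := Fintype.card N + 1) (by omega) ?_ ?_
  · refine le_trans (le_of_eq ?_) (key.trans (by push_cast; rfl))
    rw [Fintype.sum_sum_type]
    congr 1
    · rw [← hCw]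
      simp [B, copiesValuation, Finset.image_image, e, Function.comp_def, two_mul]
    · exact Finset.sum_congr rfl fun i _ => (hDw i).symm
  · intro i
    rw [Fintype.sum_sum_type]
    have h1 : ∑ b : Bool, (B (Sum.inl b) i).card ≤ 2 := by
      simpa using Finset.sum_le_card_nsmul Finset.univ _ 1 fun b _ => hB1 (Sum.inl b) i
    have h2 : ∑ l, (B (Sum.inr l) i).card ≤ Fintype.card N - 1 := by
      rw [← Finset.add_sum_erase _ _ (Finset.mem_univ i)]
      have := Finset.sum_le_card_nsmul (Finset.univ.erase i) _ 1 fun l _ => hB1 (Sum.inr l) i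
      simpa [B, hD0, Finset.card_erase_of_mem] using this
    have : 0 < Fintype.card N := Fintype.card_pos_iff.mpr ⟨i⟩
    omega
  · intro x
    rw [Fintype.sum_sum_type, add_comm]
    refine add_le_add ?_ ?_
    · exact (Finset.sum_le_card_nsmul Finset.univ _ 1 fun l _ =>
        (hD l).card_filter_mem_le_one x).trans (by simp)
    · calc ∑ b : Bool, (Finset.univ.filter fun i => x ∈ B (Sum.inl b) i).card
          ≤ ∑ b : Bool, if b = decide (k ≤ (x.2 : ℕ)) then 1 else 0 := by
            refine Finset.sum_le_sum fun b _ => ?_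
            split_ifs with hb
            · refine Finset.card_le_one.mpr fun i hi l hl => ?_
              by_contra hil
              simp only [B, Sum.elim_inl, Finset.mem_filter, Finset.mem_univ, true_and,
                Finset.mem_image] at hi hl
              obtain ⟨y, hy, hyx⟩ := hi
              obtain ⟨z, hz, hzx⟩ := hl
              obtain rfl := he b (hyx.trans hzx.symm)
              exact Finset.disjoint_left.mp (hC.disjoint i l hil) hy hz
            · refine (Finset.card_eq_zero.mpr
                (Finset.filter_eq_empty_iff.mpr fun i _ hi => hb ?_)).le
              simp only [B, Sum.elim_inl, Finset.mem_image] at hi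
              obtain ⟨y, -, rfl⟩ := hi
              have := y.2.2
              cases b <;> simp [e]
        _ = 1 := by simp

end UnitDemand

/-! ### Expectations under mixtures and images -/

section Expectation

variable {α β : Type*}

theorem expect_pure (a : α) (f : α → ℝ) : expect (PMF.pure a) f = f a := by
  rw [expect, tsum_eq_single a fun b hb => by simp [hb]]
  simp

theorem expect_bind [Fintype α] (P : PMF α) (g : α → PMF β) (hg : ∀ a, (g a).support.Finite)
    (f : β → ℝ) : expect (P.bind g) f = ∑ a, (P a).toReal * expect (g a) f := by
  have h (b : β) : (P.bind g b).toReal * f b = ∑ a, (P a).toReal * ((g a b).toReal * f b) := by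
    rw [PMF.bind_apply, tsum_fintype, ENNReal.toReal_sum fun a _ =>
      ENNReal.mul_ne_top (P.apply_ne_top a) ((g a).apply_ne_top b), Finset.sum_mul]
    simp only [ENNReal.toReal_mul, mul_assoc]
  simp only [expect, h]
  rw [Summable.tsum_finsetSum]
  · simp only [tsum_mul_left]
  · refine fun a _ => summable_of_hasFiniteSupport ((hg a).subset fun b hb => ?_)
    contrapose! hb
    simp [(PMF.apply_eq_zero_iff _ _).mpr hb]

theorem expect_map [Fintype α] (P : PMF α) (g : α → β) (f : β → ℝ) :
    expect (P.map g) f = ∑ a, (P a).toReal * f (g a) := by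
  rw [PMF.map, expect_bind _ _ fun a => by simp [PMF.support_pure]]
  simp [expect_pure]

theorem finite_support_map [Finite α] (P : PMF α) (g : α → β) : (P.map g).support.Finite := by
  rw [PMF.support_map]
  exact Set.toFinite _

end Expectation

/-! ### Rounding -/

section Rounding

variable {N I : Type*} [Fintype I] [DecidableEq I] {k : ℕ}

theorem isAllocation_roundOutcome {A : Bundles N (I × Fin k)} (hA : IsAllocation Finset.univ A)
    (p : N → ℝ) (c : I → Fin k) : IsAllocation Finset.univ (roundOutcome A p c).1 := by
  refine ⟨fun _ => Finset.subset_univ _, fun i l hil => Finset.disjoint_left.mpr fun j hi hl => ?_⟩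
  simp only [roundOutcome, Finset.mem_filter, Finset.mem_univ, true_and] at hi hl
  exact Finset.disjoint_left.mp (hA.disjoint i l hil) hi hl

/-- An agent who holds at most one copy of an item either receives the whole of what she won or
nothing. -/
theorem utility_roundOutcome {u : Valuation I} (hu : u ∅ = 0) {A : Bundles N (I × Fin k)} {i : N}
    {x : I × Fin k} (hx : A i = {x}) (p : N → ℝ) (c : I → Fin k) :
    utility u i (roundOutcome A p c) =
      if c x.1 = x.2 then copiesValuation k u (A i) - p i else 0 := by
  have hB : (Finset.univ.filter fun j => (j, c j) ∈ A i) = if c x.1 = x.2 then {x.1} else ∅ := by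
    ext j
    rw [hx]
    simp only [Finset.mem_filter, Finset.mem_univ, true_and, Finset.mem_singleton, Prod.ext_iff]
    split_ifs with h
    · simp only [Finset.mem_singleton, and_iff_left_iff_imp]
      rintro rfl
      exact h
    · simp only [Finset.notMem_empty, iff_false, not_and]
      rintro rfl
      exact h
  simp only [utility, roundOutcome, hB]
  split_ifs with h1 h2 h2
  · simp [copiesValuation, hx]
  · simp at h2
  · simp at h2
  · simp [hu]

theorem utility_roundOutcome_of_eq_empty {u : Valuation I} (hu : u ∅ = 0)
    {A : Bundles N (I × Fin k)} {i : N} (hA : A i = ∅) (p : N → ℝ) (c : I → Fin k) :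
    utility u i (roundOutcome A p c) = 0 := by
  simp [utility, roundOutcome, hA, hu]

theorem sum_fun_ite_eq {R : Type*} [Fintype R] [DecidableEq R] (j : I) (a : R) (t : ℝ) :
    ∑ c : I → R, (if c j = a then t else 0) =
      Fintype.card (I → R) * ((Fintype.card R : ℝ)⁻¹ * t) := by
  have hR : (Fintype.card R : ℝ) ≠ 0 := by
    exact_mod_cast (Fintype.card_pos_iff.mpr ⟨a⟩).ne'
  rw [Fintype.card_congr (Equiv.funSplitAt j R), ← (Equiv.funSplitAt j R).symm.sum_comp,
    Fintype.sum_prod_type]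
  simp only [Equiv.funSplitAt, Equiv.piSplitAt_symm_apply, dite_true, Fintype.card_prod]
  simp
  field_simp

/-- Rounding scales the utility from the instance with `k` copies down by a factor `k`. -/
theorem sum_utility_roundOutcome {u : Valuation I} (hu : u ∅ = 0) {A : Bundles N (I × Fin k)}
    {i : N} (hA : (A i).card ≤ 1) {p : N → ℝ} (hp : A i = ∅ → p i = 0) :
    ∑ c : I → Fin k, utility u i (roundOutcome A p c) =
      Fintype.card (I → Fin k) * ((k : ℝ)⁻¹ * (copiesValuation k u (A i) - p i)) := by
  rcases (A i).eq_empty_or_nonempty with h | h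
  · simp [utility_roundOutcome_of_eq_empty hu h, hp h, h, copiesValuation, hu]
  · obtain ⟨x, hx⟩ := Finset.card_eq_one.mp (hA.antisymm h.card_pos)
    simp only [utility_roundOutcome hu hx, sum_fun_ite_eq, Fintype.card_fin]

end Rounding

/-! ### VCG with copies -/

section Mechanism

variable {N I : Type*} [Fintype N] [Fintype I] [DecidableEq I]

theorem VCGRule.card_allocate_le_one {J : Type*} [Fintype J] [DecidableEq J] (R : VCGRule N J)
    {v : Profile N J} (hv : ∀ i, IsUnitDemand (v i)) (i : N) : (R.allocate v i).card ≤ 1 :=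
  (hv i).card_le_one ((R.spec v fun i => (hv i).toIsValuation).nonredundant i)

theorem optWelfare_copies_one {v : Profile N I} (T : Finset N) :
    optWelfare (fun i => copiesValuation (2 ^ 0) (v i)) T Finset.univ =
      optWelfare v T Finset.univ := by
  let e : I × Fin (2 ^ 0) ≃ I := Equiv.prodUnique I (Fin 1)
  refine (optWelfare_le fun A hA => ?_).antisymm (optWelfare_le fun A hA => ?_)
  · refine IsAllocation.sum_le_optWelfare (A := fun i => (A i).image Prod.fst)
      ⟨fun _ => Finset.subset_univ _, fun i k hik => ?_⟩ v T
    exact (Finset.disjoint_image e.injective).mpr (hA.disjoint i k hik)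
  · refine le_trans (le_of_eq ?_) (IsAllocation.sum_le_optWelfare
      (A := fun i => (A i).image e.symm) ⟨fun _ => Finset.subset_univ _, fun i k hik =>
        (Finset.disjoint_image e.symm.injective).mpr (hA.disjoint i k hik)⟩ _ T)
    refine Finset.sum_congr rfl fun i _ => ?_
    rw [copiesValuation, Finset.image_image]
    congr 1
    exact (Finset.image_id (s := A i)).symm

variable [DecidableEq N]

theorem vcgPayment_nonneg {J : Type*} [Fintype J] [DecidableEq J] (v : Profile N J)
    (A : Bundles N J) (i : N) : 0 ≤ vcgPayment v A i :=
  sub_nonneg.mpr (optWelfare_mono_items v _ (Finset.subset_univ _))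

theorem vcgPayment_eq_zero {J : Type*} [Fintype J] [DecidableEq J] (v : Profile N J)
    {A : Bundles N J} {i : N} (h : A i = ∅) : vcgPayment v A i = 0 := by
  simp [vcgPayment, h]

/-- The utility of a truthful agent in VCG is her contribution to the optimal welfare. -/
theorem IsVCGAllocation.sub_vcgPayment {J : Type*} [Fintype J] [DecidableEq J] {v : Profile N J}
    {A : Bundles N J} (hA : IsVCGAllocation v A) (i : N) :
    v i (A i) - vcgPayment v A i = optWelfare v Finset.univ Finset.univ -
      optWelfare v (Finset.univ.erase i) Finset.univ := by
  have := hA.add_optWelfare_eq i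
  rw [vcgPayment]
  linarith

theorem expect_vcgWithCopies (R : (ℓ : ℕ) → VCGRule N (I × Fin (2 ^ ℓ))) (r : ℕ)
    (v : Profile N I) (f : Outcome N I → ℝ) :
    expect (vcgWithCopies R r v) f = ∑ ℓ : Fin (r + 1), ((r : ℝ) + 1)⁻¹ *
      ∑ c : I → Fin (2 ^ (ℓ : ℕ)), (Fintype.card (I → Fin (2 ^ (ℓ : ℕ))) : ℝ)⁻¹ *
        f (roundOutcome ((R ℓ).allocate fun i => copiesValuation (2 ^ (ℓ : ℕ)) (v i))
          (vcgPayment (fun i => copiesValuation (2 ^ (ℓ : ℕ)) (v i))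
            ((R ℓ).allocate fun i => copiesValuation (2 ^ (ℓ : ℕ)) (v i))) c) := by
  rw [vcgWithCopies, expect_bind _ _ fun ℓ => finite_support_map _ _]
  refine Finset.sum_congr rfl fun ℓ _ => ?_
  rw [expect_map]
  simp only [PMF.uniformOfFintype_apply, ENNReal.toReal_inv, ENNReal.toReal_natCast,
    Fintype.card_fin]
  simp only [Nat.cast_add, Nat.cast_one]

theorem mem_support_vcgWithCopies {R : (ℓ : ℕ) → VCGRule N (I × Fin (2 ^ ℓ))} {r : ℕ}
    {v : Profile N I} {o : Outcome N I} (ho : o ∈ (vcgWithCopies R r v).support) :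
    ∃ (ℓ : ℕ) (c : I → Fin (2 ^ ℓ)),
      o = roundOutcome ((R ℓ).allocate fun i => copiesValuation (2 ^ ℓ) (v i))
        (vcgPayment (fun i => copiesValuation (2 ^ ℓ) (v i))
          ((R ℓ).allocate fun i => copiesValuation (2 ^ ℓ) (v i))) c := by
  obtain ⟨ℓ, -, hℓ⟩ := (PMF.mem_support_bind_iff _ _ _).mp ho
  obtain ⟨c, -, hc⟩ := (PMF.mem_support_map_iff _ _ _).mp hℓ
  exact ⟨ℓ, c, hc.symm⟩

theorem isFeasible_vcgWithCopies (R : (ℓ : ℕ) → VCGRule N (I × Fin (2 ^ ℓ))) (r : ℕ) :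
    IsFeasible IsUnitDemand (vcgWithCopies R r) := by
  refine fun v hv => ⟨?_, fun o ho => ?_⟩
  · rw [vcgWithCopies, PMF.support_bind]
    exact Set.toFinite _ |>.biUnion fun ℓ _ => finite_support_map _ _
  · obtain ⟨ℓ, c, rfl⟩ := mem_support_vcgWithCopies ho
    have hA := (R ℓ).spec _ fun i => ((hv i).copies (2 ^ ℓ)).toIsValuation
    refine ⟨isAllocation_roundOutcome hA.isAllocation _ _, fun i => ?_⟩
    simp only [roundOutcome]
    split_ifs
    · exact vcgPayment_nonneg _ _ _
    · rfl

theorem isExPostIR_vcgWithCopies (R : (ℓ : ℕ) → VCGRule N (I × Fin (2 ^ ℓ))) (r : ℕ) :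
    IsExPostIR IsUnitDemand (vcgWithCopies R r) := by
  intro v hv o ho i
  obtain ⟨ℓ, c, rfl⟩ := mem_support_vcgWithCopies ho
  have hv' (i : N) := (hv i).copies (2 ^ ℓ)
  have hA := (R ℓ).spec _ fun i => (hv' i).toIsValuation
  rcases ((R ℓ).allocate (fun i => copiesValuation (2 ^ ℓ) (v i)) i).eq_empty_or_nonempty
    with h | h
  · exact (utility_roundOutcome_of_eq_empty (hv i).normalized h _ _).ge
  · obtain ⟨x, hx⟩ :=
      Finset.card_eq_one.mp (((R ℓ).card_allocate_le_one hv' i).antisymm h.card_pos)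
    rw [utility_roundOutcome (hv i).normalized hx]
    split_ifs
    · rw [hA.sub_vcgPayment i]
      exact sub_nonneg.mpr (optWelfare_erase_le (fun i => (hv' i).toIsValuation) _ _)
    · rfl

/-- The expected utility, for the valuation `u`, of agent `i` when the profile `v` is reported. -/
theorem expect_utility_vcgWithCopies (R : (ℓ : ℕ) → VCGRule N (I × Fin (2 ^ ℓ))) (r : ℕ)
    {v : Profile N I} (hv : ∀ i, IsUnitDemand (v i)) {u : Valuation I} (hu : u ∅ = 0) (i : N) :
    expect (vcgWithCopies R r v) (utility u i) = ∑ ℓ : Fin (r + 1), ((r : ℝ) + 1)⁻¹ *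
      (((2 : ℝ) ^ (ℓ : ℕ))⁻¹ *
        (copiesValuation (2 ^ (ℓ : ℕ)) u
          ((R ℓ).allocate (fun i => copiesValuation (2 ^ (ℓ : ℕ)) (v i)) i) -
        vcgPayment (fun i => copiesValuation (2 ^ (ℓ : ℕ)) (v i))
          ((R ℓ).allocate fun i => copiesValuation (2 ^ (ℓ : ℕ)) (v i)) i)) := by
  rw [expect_vcgWithCopies]
  refine Finset.sum_congr rfl fun ℓ _ => ?_
  rw [← Finset.mul_sum, sum_utility_roundOutcome hu
    ((R ℓ).card_allocate_le_one (fun i => (hv i).copies _) i) (vcgPayment_eq_zero _)]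
  have : (Fintype.card (I → Fin (2 ^ (ℓ : ℕ))) : ℝ) ≠ 0 := by
    exact_mod_cast Fintype.card_ne_zero
  rw [inv_mul_cancel_left₀ this]
  simp

theorem isTruthfulInExpectation_vcgWithCopies (R : (ℓ : ℕ) → VCGRule N (I × Fin (2 ^ ℓ)))
    (r : ℕ) : IsTruthfulInExpectation IsUnitDemand (vcgWithCopies R r) := by
  intro v hv i b hb
  have hvb (k : N) : IsUnitDemand (Function.update v i b k) := by
    rcases eq_or_ne k i with rfl | hk
    · simpa using hb
    · simpa [hk] using hv k
  rw [expect_utility_vcgWithCopies R r hvb (hv i).normalized,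
    expect_utility_vcgWithCopies R r hv (hv i).normalized]
  refine Finset.sum_le_sum fun ℓ _ => mul_le_mul_of_nonneg_left
    (mul_le_mul_of_nonneg_left ?_ (by positivity)) (by positivity)
  set v' : Profile N (I × Fin (2 ^ (ℓ : ℕ))) := fun k => copiesValuation (2 ^ (ℓ : ℕ)) (v k)
  have hA := (R ℓ).spec v' fun k => ((hv k).copies _).toIsValuation
  rw [show copiesValuation (2 ^ (ℓ : ℕ)) (v i) = v' i from rfl, hA.sub_vcgPayment i]
  -- Whatever bundle the report wins, its price depends only on the reports of the others.
  generalize (R ℓ).allocate (fun k => copiesValuation (2 ^ (ℓ : ℕ)) (Function.update v i b k)) = A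
  have hcongr : ∀ k ∈ Finset.univ.erase i,
      copiesValuation (2 ^ (ℓ : ℕ)) (Function.update v i b k) = v' k := fun k hk => by
    rw [Function.update_of_ne (Finset.ne_of_mem_erase hk)]
  rw [vcgPayment, optWelfare_congr _ hcongr, optWelfare_congr _ hcongr]
  linarith [add_optWelfare_le v' i (A i)]

/-- The expected residual surplus is an average of the total contributions of the agents to the
optimal welfare of the instances with copies, the instance with `2 ^ ℓ` copies being discounted by
the service probability `1 / 2 ^ ℓ`. -/
theorem expect_residualSurplus_vcgWithCopies (R : (ℓ : ℕ) → VCGRule N (I × Fin (2 ^ ℓ)))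
    (r : ℕ) {v : Profile N I} (hv : ∀ i, IsUnitDemand (v i)) :
    expect (vcgWithCopies R r v) (residualSurplus v) = ((r : ℝ) + 1)⁻¹ *
      ∑ ℓ ∈ Finset.range (r + 1), ((2 : ℝ) ^ ℓ)⁻¹ *
        ∑ i, (optWelfare (fun i => copiesValuation (2 ^ ℓ) (v i)) Finset.univ Finset.univ -
          optWelfare (fun i => copiesValuation (2 ^ ℓ) (v i)) (Finset.univ.erase i)
            Finset.univ) := by
  have h : expect (vcgWithCopies R r v) (residualSurplus v) =
      ∑ i, expect (vcgWithCopies R r v) (utility (v i) i) := by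
    simp only [expect_vcgWithCopies]
    rw [Finset.sum_comm]
    refine Finset.sum_congr rfl fun ℓ _ => ?_
    simp only [← Finset.mul_sum]
    rw [Finset.sum_comm]
    rfl
  rw [h, Finset.sum_congr rfl fun i _ => expect_utility_vcgWithCopies R r hv (hv i).normalized i,
    Finset.sum_comm, Finset.sum_range, Finset.mul_sum]
  refine Finset.sum_congr rfl fun ℓ _ => ?_
  rw [← Finset.mul_sum, ← Finset.mul_sum]
  congr 2
  refine Finset.sum_congr rfl fun i _ => ?_
  exact ((R ℓ).spec _ fun i => ((hv i).copies _).toIsValuation).sub_vcgPayment i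

/-- Telescoping over the number of copies: the surplus from `2 ^ (ℓ + 1)` copies is at least
`2 * W ℓ - W (ℓ + 1)`, where `W ℓ` is the optimal welfare with `2 ^ ℓ` copies. -/
theorem sub_le_expect_residualSurplus (R : (ℓ : ℕ) → VCGRule N (I × Fin (2 ^ ℓ)))
    (r : ℕ) {v : Profile N I} (hv : ∀ i, IsUnitDemand (v i)) :
    ((r : ℝ) + 1)⁻¹ * (optWelfare v Finset.univ Finset.univ -
        ((2 : ℝ) ^ r)⁻¹ * ∑ i, v i Finset.univ) ≤
      expect (vcgWithCopies R r v) (residualSurplus v) := by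
  rw [expect_residualSurplus_vcgWithCopies R r hv]
  gcongr
  set W : ℕ → ℝ := fun ℓ =>
    optWelfare (fun i => copiesValuation (2 ^ ℓ) (v i)) Finset.univ Finset.univ
  have hW0 : W 0 = optWelfare v Finset.univ Finset.univ := optWelfare_copies_one _
  have hWr : W r ≤ ∑ i, v i Finset.univ := by
    refine (optWelfare_le_sum_univ (fun i => ((hv i).copies _).toIsValuation) _ _).trans ?_
    exact Finset.sum_le_sum fun i _ => (hv i).mono _ _ (Finset.subset_univ _)
  have htel : W 0 - ((2 : ℝ) ^ r)⁻¹ * W r =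
      ∑ ℓ ∈ Finset.range r, ((2 : ℝ) ^ (ℓ + 1))⁻¹ * (2 * W ℓ - W (ℓ + 1)) := by
    have := Finset.sum_range_sub' (fun ℓ => ((2 : ℝ) ^ ℓ)⁻¹ * W ℓ) r
    simp only [pow_zero, inv_one, one_mul] at this
    rw [← this]
    refine Finset.sum_congr rfl fun ℓ _ => ?_
    rw [pow_succ]
    field_simp
  rw [← hW0]
  have hle : W 0 - ((2 : ℝ) ^ r)⁻¹ * ∑ i, v i Finset.univ ≤ W 0 - ((2 : ℝ) ^ r)⁻¹ * W r := by
    gcongr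
  refine hle.trans ?_
  rw [htel, Finset.sum_range_succ']
  refine le_add_of_le_of_nonneg (Finset.sum_le_sum fun ℓ _ => ?_) ?_
  · gcongr
    have := two_mul_add_sum_le hv (k := 2 ^ ℓ) (k' := 2 ^ (ℓ + 1)) (pow_succ' 2 ℓ).ge
    rw [Finset.sum_sub_distrib, Finset.sum_const, Finset.card_univ, nsmul_eq_mul]
    linarith
  · refine mul_nonneg (by positivity) (Finset.sum_nonneg fun i _ => sub_nonneg.mpr ?_)
    exact optWelfare_erase_le (fun i => ((hv i).copies _).toIsValuation) _ _

/-- The residual surplus is at least the discounted utility of one agent, who without copies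
already contributes her value minus what the others are worth at most. -/
theorem sub_sum_erase_le_expect_residualSurplus (R : (ℓ : ℕ) → VCGRule N (I × Fin (2 ^ ℓ)))
    (r : ℕ) {v : Profile N I} (hv : ∀ i, IsUnitDemand (v i)) (i : N) :
    ((r : ℝ) + 1)⁻¹ * (v i Finset.univ - ∑ k ∈ Finset.univ.erase i, v k Finset.univ) ≤
      expect (vcgWithCopies R r v) (residualSurplus v) := by
  rw [expect_residualSurplus_vcgWithCopies R r hv]
  gcongr
  have hnn (ℓ : ℕ) (k : N) :
      0 ≤ optWelfare (fun i => copiesValuation (2 ^ ℓ) (v i)) Finset.univ Finset.univ -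
        optWelfare (fun i => copiesValuation (2 ^ ℓ) (v i)) (Finset.univ.erase k) Finset.univ :=
    sub_nonneg.mpr (optWelfare_erase_le (fun i => ((hv i).copies _).toIsValuation) _ _)
  refine le_trans ?_ (Finset.single_le_sum (fun ℓ _ => mul_nonneg (by positivity)
    (Finset.sum_nonneg fun k _ => hnn ℓ k)) (Finset.mem_range.mpr r.succ_pos))
  rw [pow_zero, inv_one, one_mul]
  refine le_trans ?_ (Finset.single_le_sum (fun k _ => hnn 0 k) (Finset.mem_univ i))
  rw [optWelfare_copies_one, optWelfare_copies_one]
  have h1 := add_optWelfare_le v i Finset.univ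
  have h2 := optWelfare_nonneg (fun k => (hv k).toIsValuation) (Finset.univ.erase i)
    (Finset.univ \ Finset.univ)
  have h3 := optWelfare_le_sum_univ (fun k => (hv k).toIsValuation) (Finset.univ.erase i)
    Finset.univ
  linarith

end Mechanism

/-! ### The maximum of independent random variables -/

section CorrelationGap

/-- The bound `1 - exp (-s) ≥ (1 - exp (-1)) * min 1 s`, scaled to sums `s ≤ D` with `1 ≤ D`. -/
theorem mul_sum_le_one_sub_prod {ι : Type*} [Fintype ι] {p : ι → ℝ} (h0 : ∀ i, 0 ≤ p i)
    (h1 : ∀ i, p i ≤ 1) {D : ℝ} (hD : 1 ≤ D) (hs : ∑ i, p i ≤ D) :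
    (1 - Real.exp (-1)) / D * ∑ i, p i ≤ 1 - ∏ i, (1 - p i) := by
  have hprod : ∏ i, (1 - p i) ≤ Real.exp (-∑ i, p i) := by
    rw [← Finset.sum_neg_distrib, Real.exp_sum]
    exact Finset.prod_le_prod (fun i _ => sub_nonneg.mpr (h1 i)) fun i _ =>
      Real.one_sub_le_exp_neg (p i)
  have hs0 : 0 ≤ ∑ i, p i := Finset.sum_nonneg fun i _ => h0 i
  generalize ∑ i, p i = s at *
  have he : 0 ≤ 1 - Real.exp (-1) := sub_nonneg.mpr (Real.exp_le_one_iff.mpr (by norm_num))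
  refine le_trans ?_ (sub_le_sub_left hprod 1)
  rcases le_total s 1 with h | h
  · have hconv := convexOn_exp.2 (Set.mem_univ (-1)) (Set.mem_univ 0) hs0 (sub_nonneg.mpr h)
      (by ring)
    simp only [smul_eq_mul, mul_zero, add_zero, Real.exp_zero, mul_one, mul_neg] at hconv
    have : (1 - Real.exp (-1)) / D * s ≤ (1 - Real.exp (-1)) * s := by
      gcongr
      exact div_le_self he hD
    linarith
  · have h2 : (1 - Real.exp (-1)) / D * s ≤ 1 - Real.exp (-1) := by
      rw [div_mul_eq_mul_div, div_le_iff₀ (by linarith)]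
      gcongr
    have h3 : Real.exp (-s) ≤ Real.exp (-1) := Real.exp_le_exp.mpr (by linarith)
    linarith

variable {ι Ω : Type*} [Fintype ι] [MeasurableSpace Ω] (μ : ι → Measure Ω)
  [∀ i, IsProbabilityMeasure (μ i)]

theorem mul_sum_measure_le_measure_exists {S : ι → Set Ω} (hS : ∀ i, MeasurableSet (S i)) {D : ℝ}
    (hD : 1 ≤ D) (hs : ∑ i, μ i (S i) ≤ ENNReal.ofReal D) :
    ENNReal.ofReal ((1 - Real.exp (-1)) / D) * ∑ i, μ i (S i) ≤
      Measure.pi μ {ω | ∃ i, ω i ∈ S i} := by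
  have hset : {ω : ι → Ω | ∃ i, ω i ∈ S i} = (Set.univ.pi fun i => (S i)ᶜ)ᶜ := by
    ext ω
    simp
  have hsum : ∑ i, μ i (S i) = ENNReal.ofReal (∑ i, (μ i).real (S i)) := by
    rw [ENNReal.ofReal_sum_of_nonneg fun i _ => measureReal_nonneg]
    exact Finset.sum_congr rfl fun i _ => (ofReal_measureReal).symm
  have hpi : (Measure.pi μ).real {ω | ∃ i, ω i ∈ S i} = 1 - ∏ i, (1 - (μ i).real (S i)) := by
    rw [hset, probReal_compl_eq_one_sub (MeasurableSet.univ_pi fun i => (hS i).compl),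
      measureReal_def, Measure.pi_pi, ENNReal.toReal_prod]
    congr 1
    exact Finset.prod_congr rfl fun i _ => probReal_compl_eq_one_sub (hS i)
  have he : 0 ≤ 1 - Real.exp (-1) := sub_nonneg.mpr (Real.exp_le_one_iff.mpr (by norm_num))
  rw [hsum, ENNReal.ofReal_le_ofReal_iff (by linarith)] at hs
  rw [hsum, ← ENNReal.ofReal_mul (by positivity), ← ofReal_measureReal, hpi]
  exact ENNReal.ofReal_le_ofReal (mul_sum_le_one_sub_prod (fun _ => measureReal_nonneg)
    (fun _ => measureReal_le_one) hD hs)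

theorem lintegral_coe_nnreal_eq_lintegral_meas_lt {Ω : Type*} [MeasurableSpace Ω] (μ : Measure Ω)
    {f : Ω → NNReal} (hf : Measurable f) :
    ∫⁻ ω, (f ω : ℝ≥0∞) ∂μ = ∫⁻ t in Set.Ioi (0 : ℝ), μ {ω | t < f ω} := by
  simpa using lintegral_eq_lintegral_meas_lt μ (f := fun ω => (f ω : ℝ))
    (Filter.Eventually.of_forall fun ω => (f ω).2) (by fun_prop)

theorem measurable_finset_sup_eval {ι Ω : Type*} [MeasurableSpace Ω] (s : Finset ι)
    {X : ι → Ω → NNReal} (hX : ∀ i, Measurable (X i)) :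
    Measurable fun ω : ι → Ω => s.sup fun i => X i (ω i) := by
  classical
  induction s using Finset.induction_on with
  | empty => simp
  | insert a s _ ih =>
    simp only [Finset.sup_insert]
    exact ((hX a).comp (measurable_pi_apply a)).sup ih

/-- The correlation gap inequality for the maximum: independent nonnegative random variables,
of which at most `D` are positive in expectation, have a maximum whose expectation is at least
`(1 - exp (-1)) / D` times the sum of their expectations. -/
theorem mul_sum_lintegral_le_lintegral_sup {X : ι → Ω → NNReal} (hX : ∀ i, Measurable (X i))
    {D : ℝ} (hD : 1 ≤ D) (hs : ∑ i, μ i {ω | 0 < X i ω} ≤ ENNReal.ofReal D) :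
    ENNReal.ofReal ((1 - Real.exp (-1)) / D) * ∑ i, ∫⁻ ω, X i ω ∂(μ i) ≤
      ∫⁻ ω, ((Finset.univ.sup fun i => X i (ω i) : NNReal) : ℝ≥0∞) ∂(Measure.pi μ) := by
  have hmeas (i : ι) : Measurable fun t : ℝ => μ i {ω | t < X i ω} :=
    Antitone.measurable fun s t hst => measure_mono fun ω hω => lt_of_le_of_lt hst hω
  rw [lintegral_coe_nnreal_eq_lintegral_meas_lt _ (measurable_finset_sup_eval _ hX)]
  simp only [lintegral_coe_nnreal_eq_lintegral_meas_lt _ (hX _)]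
  rw [← lintegral_finsetSum _ fun i _ => hmeas i, ← lintegral_const_mul _
    (Finset.measurable_sum _ fun i _ => hmeas i)]
  refine setLIntegral_mono' measurableSet_Ioi fun t ht => ?_
  have ht' : 0 ≤ t := le_of_lt ht
  refine (mul_sum_measure_le_measure_exists μ (S := fun i => {ω | t < X i ω})
    (fun i => measurableSet_lt measurable_const (by fun_prop)) hD
    ((Finset.sum_le_sum fun i _ => measure_mono fun ω hω => ?_).trans hs)).trans
    (measure_mono ?_)
  · exact_mod_cast lt_of_le_of_lt ht' hω
  · rintro ω ⟨i, hi⟩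
    refine lt_of_lt_of_le (Set.mem_ofPred.mp hi) ?_
    exact_mod_cast Finset.le_sup (f := fun i => X i (ω i)) (Finset.mem_univ i)

/-- If one of finitely many independent random variables has infinite expectation, then so has its
excess over the sum of the others: with positive probability the others are bounded. -/
theorem lintegral_sub_sum_erase_eq_top [DecidableEq ι] {X : Ω → ℝ} (hX : Measurable X) (i : ι)
    (hi : ∫⁻ ω, ENNReal.ofReal (X ω) ∂(μ i) = ∞) :
    ∫⁻ ω, ENNReal.ofReal (X (ω i) - ∑ k ∈ Finset.univ.erase i, X (ω k)) ∂(Measure.pi μ) = ∞ := by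
  have hT (k : ι) : ∃ T : ℕ, μ k {ω | X ω ≤ T} ≠ 0 := by
    by_contra! h
    have : μ k (⋃ T : ℕ, {ω | X ω ≤ T}) = 0 := measure_iUnion_null h
    have huniv : (⋃ T : ℕ, {ω | X ω ≤ T}) = Set.univ :=
      Set.iUnion_eq_univ_iff.mpr fun ω => exists_nat_ge (X ω)
    simp [huniv] at this
  choose T hT using hT
  set t : ℝ := ∑ k ∈ Finset.univ.erase i, (T k : ℝ)
  -- the product of the `g k` is a lower bound that factorizes by independence
  let g : ι → Ω → ℝ≥0∞ := fun k =>
    if k = i then fun ω => ENNReal.ofReal (X ω - t) else {ω | X ω ≤ T k}.indicator 1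
  have hg (k : ι) : Measurable (g k) := by
    simp only [g]
    split_ifs
    · fun_prop
    · exact measurable_one.indicator (measurableSet_le hX measurable_const)
  have hgi : ∫⁻ ω, g i ω ∂(μ i) = ∞ := by
    simp only [g, if_true]
    by_contra hne
    have h1 : ∫⁻ ω, ENNReal.ofReal (X ω) ∂(μ i) ≤
        ∫⁻ ω, ENNReal.ofReal (X ω - t) + ENNReal.ofReal t ∂(μ i) := by
      refine lintegral_mono fun ω => ?_
      simpa using ENNReal.ofReal_add_le (p := X ω - t) (q := t)
    rw [hi, lintegral_add_right _ measurable_const, lintegral_const, measure_univ, mul_one,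
      top_le_iff, ENNReal.add_eq_top] at h1
    simp [hne] at h1
  have hprod : ∫⁻ ω, ∏ k, g k (ω k) ∂(Measure.pi μ) = ∏ k, ∫⁻ ω, g k ω ∂(μ k) := by
    rw [lintegral_prod_eq_prod_lintegral_of_indepFun Finset.univ
      (fun (k : ι) (ω : ι → Ω) => g k (ω k))
      (iIndepFun_pi fun k => (hg k).aemeasurable) fun k => (hg k).comp (measurable_pi_apply k)]
    exact Finset.prod_congr rfl fun k _ =>
      (measurePreserving_eval μ k).lintegral_comp (hg k)
  rw [← top_le_iff]
  calc ∞ = ∏ k, ∫⁻ ω, g k ω ∂(μ k) := by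
        rw [← Finset.mul_prod_erase _ _ (Finset.mem_univ i), hgi, ENNReal.top_mul]
        refine Finset.prod_ne_zero_iff.mpr fun k hk => ?_
        simp only [g, if_neg (Finset.ne_of_mem_erase hk)]
        rw [lintegral_indicator_one (measurableSet_le hX measurable_const)]
        exact hT k
    _ = ∫⁻ ω, ∏ k, g k (ω k) ∂(Measure.pi μ) := hprod.symm
    _ ≤ _ := by
        refine lintegral_mono fun ω => ?_
        rw [← Finset.mul_prod_erase _ _ (Finset.mem_univ i)]
        by_cases h : ∀ k ∈ Finset.univ.erase i, X (ω k) ≤ T k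
        · rw [Finset.prod_eq_one, mul_one]
          · simp only [g, if_true]
            exact ENNReal.ofReal_le_ofReal (sub_le_sub_left (Finset.sum_le_sum h) _)
          · intro k hk
            simp [g, if_neg (Finset.ne_of_mem_erase hk), h k hk]
        · push Not at h
          obtain ⟨k, hk, hlt⟩ := h
          rw [Finset.prod_eq_zero hk, mul_zero]
          · exact bot_le
          · simp [g, if_neg (Finset.ne_of_mem_erase hk), hlt]

end CorrelationGap

/-! ### The uniform highest value assumption -/

section Favourites

variable {N I : Type*} [Fintype N] [Fintype I]

/-- The welfare of the allocation that gives every item to the agent who values it most among those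
whose favourite item `f i` it is; every agent gets at most her favourite item. -/
theorem sum_sup_le_optWelfare [DecidableEq I] {v : Profile N I} (hv : ∀ i, IsUnitDemand (v i))
    (f : N → I) :
    ∑ j, ((Finset.univ.sup fun i => if f i = j then (v i {j}).toNNReal else 0 : NNReal) : ℝ) ≤
      optWelfare v Finset.univ Finset.univ := by
  classical
  rcases isEmpty_or_nonempty N with hN | hN
  · simpa using optWelfare_nonneg (fun i => (hv i).toIsValuation) Finset.univ Finset.univ
  choose w _ hw using fun j : I => Finset.exists_mem_eq_sup (Finset.univ : Finset N)
    Finset.univ_nonempty fun i => if f i = j then (v i {j}).toNNReal else 0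
  let A : Bundles N I := fun i => Finset.univ.filter fun j => w j = i ∧ f i = j
  have hA : IsAllocation Finset.univ A := by
    refine ⟨fun _ => Finset.subset_univ _, fun i k hik => Finset.disjoint_left.mpr ?_⟩
    intro j hi hk
    simp only [A, Finset.mem_filter, Finset.mem_univ, true_and] at hi hk
    exact hik (hi.1.symm.trans hk.1)
  have hA1 (i : N) : (A i).card ≤ 1 := by
    refine Finset.card_le_one.mpr fun x hx y hy => ?_
    simp only [A, Finset.mem_filter, Finset.mem_univ, true_and] at hx hy
    exact hx.2.symm.trans hy.2
  refine le_trans (le_of_eq ?_) (hA.sum_le_optWelfare v Finset.univ)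
  simp only [(hv _).eq_sum (hA1 _), A, Finset.sum_filter]
  rw [Finset.sum_comm]
  refine Finset.sum_congr rfl fun j _ => ?_
  rw [hw, Finset.sum_eq_single (w j) (fun i _ hi => if_neg fun h => hi h.1.symm) (by simp)]
  by_cases h : f (w j) = j
  · simp [h, (hv (w j)).nonneg]
  · simp [h]

theorem measurable_optWelfare (T : Finset N) (S : Finset I) :
    Measurable fun v : Profile N I => optWelfare v T S := by
  refine measurable_of_Iic fun t => ?_
  have : (fun v : Profile N I => optWelfare v T S) ⁻¹' Set.Iic t =
      ⋂ A : {A : Bundles N I // IsAllocation S A}, {v | ∑ i ∈ T, v i (A.1 i) ≤ t} := by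
    ext v
    simp only [Set.mem_preimage, Set.mem_Iic, Set.mem_iInter, Set.mem_ofPred_eq]
    exact ⟨fun h A => (A.2.sum_le_optWelfare v T).trans h,
      fun h => optWelfare_le fun A hA => h ⟨A, hA⟩⟩
  rw [this]
  exact MeasurableSet.iInter fun A => measurableSet_le (by fun_prop) measurable_const

/-- Under the uniform highest value assumption the items are worth a fraction
`(1 - exp (-1)) / max 1 (n / m)` of the sum of the agents' highest values. Every item is the
favourite one of an agent with probability `1 / m`, so the correlation gap inequality applies to
the values that it has for the agents whose favourite it is. -/
theorem mul_sum_lintegral_univ_le_lintegral_optWelfare [MeasurableSpace I]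
    [MeasurableSingletonClass I] (F : N → Measure (Valuation I)) [∀ i, IsProbabilityMeasure (F i)]
    (hF : ∀ i, ∀ᵐ v ∂(F i), IsUnitDemand v) (hu : ∀ i, UniformHighestValue (F i)) {D : ℝ}
    (hD : 1 ≤ D) (hnm : (Fintype.card N : ℝ) / Fintype.card I ≤ D) :
    ENNReal.ofReal ((1 - Real.exp (-1)) / D) *
        ∑ i, ∫⁻ v, ENNReal.ofReal (v Finset.univ) ∂(F i) ≤
      ∫⁻ v, ENNReal.ofReal (optWelfare v Finset.univ Finset.univ) ∂(Measure.pi F) := by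
  classical
  choose τ hτ hbest hunif using hu
  -- `G i` is the joint law of the valuation and the favourite item of agent `i`
  let G : N → Measure (Valuation I × I) := fun i => F i ⊗ₘ τ i
  have hG (i : N) : MeasurePreserving Prod.fst (G i) (F i) :=
    ⟨measurable_fst, Measure.fst_compProd (F i) (τ i)⟩
  have hpi : MeasurePreserving (fun (ω : N → Valuation I × I) i => (ω i).1) (Measure.pi G)
      (Measure.pi F) := measurePreserving_pi G F hG
  have hUD : ∀ᵐ ω ∂(Measure.pi G), ∀ i, IsUnitDemand (ω i).1 := by
    rw [ae_all_iff]
    exact fun i => (measurePreserving_eval G i).quasiMeasurePreserving.ae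
      ((hG i).quasiMeasurePreserving.ae (hF i))
  let X : I → Valuation I × I → NNReal := fun j ω => if ω.2 = j then (ω.1 {j}).toNNReal else 0
  have hX (j : I) : Measurable (X j) :=
    Measurable.ite (measurable_snd (measurableSet_singleton j)) (by fun_prop) measurable_const
  have hXpos (j : I) : ∑ i, G i {ω | 0 < X j ω} ≤ ENNReal.ofReal D := by
    have hle (i : N) : G i {ω | 0 < X j ω} ≤ (Fintype.card I : ℝ≥0∞)⁻¹ := by
      have hsub : {ω | 0 < X j ω} ⊆ (Prod.snd ⁻¹' {j} : Set (Valuation I × I)) := by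
        intro ω hω
        by_contra h
        simp [X, show ω.2 ≠ j from h] at hω
      refine (measure_mono hsub).trans (le_of_eq ?_)
      rw [Measure.compProd_apply (measurable_snd (measurableSet_singleton j)), ← hunif i j]
      rfl
    have : Nonempty I := ⟨j⟩
    have hm : (0 : ℝ) < Fintype.card I := by exact_mod_cast Fintype.card_pos
    refine (Finset.sum_le_sum fun i _ => hle i).trans ?_
    rw [Finset.sum_const, nsmul_eq_mul, ← div_eq_mul_inv, Finset.card_univ,
      ← ENNReal.ofReal_natCast, ← ENNReal.ofReal_natCast, ← ENNReal.ofReal_div_of_pos hm]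
    exact ENNReal.ofReal_le_ofReal hnm
  have hsum (i : N) : ∑ j, ∫⁻ ω, X j ω ∂(G i) = ∫⁻ v, ENNReal.ofReal (v Finset.univ) ∂(F i) := by
    rw [← lintegral_finsetSum _ fun j _ => by fun_prop,
      ← (hG i).lintegral_comp (f := fun v : Valuation I => ENNReal.ofReal (v Finset.univ))
        (by fun_prop)]
    have hms : MeasurableSet {ω : Valuation I × I | ∀ j, ω.1 {j} ≤ ω.1 {ω.2}} := by
      have : {ω : Valuation I × I | ∀ j, ω.1 {j} ≤ ω.1 {ω.2}} =
          ⋂ l, ⋂ j, (Prod.snd ⁻¹' {l})ᶜ ∪ {ω : Valuation I × I | ω.1 {j} ≤ ω.1 {l}} := by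
        ext ω
        simp only [Set.mem_ofPred_eq, Set.mem_iInter, Set.mem_union, Set.mem_compl_iff,
          Set.mem_preimage, Set.mem_singleton_iff]
        grind
      rw [this]
      exact MeasurableSet.iInter fun l => MeasurableSet.iInter fun j =>
        (measurable_snd (measurableSet_singleton l)).compl.union
          (measurableSet_le (by fun_prop) (by fun_prop))
    refine lintegral_congr_ae ?_
    filter_upwards [(hG i).quasiMeasurePreserving.ae (hF i),
      (Measure.ae_compProd_iff hms).mpr (hbest i)] with ω hω hmax
    have hval : ω.1 Finset.univ = ω.1 {ω.2} := by
      obtain ⟨x, -, hx⟩ := hω.exists_mem_eq (S := Finset.univ) ⟨ω.2, Finset.mem_univ _⟩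
      exact le_antisymm (hx ▸ hmax x) (hω.mono _ _ (Finset.subset_univ _))
    simp [X, hval, ENNReal.ofReal, apply_ite]
  have hmeas := (measurable_optWelfare (N := N) (I := I) Finset.univ Finset.univ).ennreal_ofReal
  calc ENNReal.ofReal ((1 - Real.exp (-1)) / D) *
        ∑ i, ∫⁻ v, ENNReal.ofReal (v Finset.univ) ∂(F i)
      = ∑ j, ENNReal.ofReal ((1 - Real.exp (-1)) / D) * ∑ i, ∫⁻ ω, X j ω ∂(G i) := by
        simp only [← hsum]
        rw [Finset.sum_comm, Finset.mul_sum]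
    _ ≤ ∑ j, ∫⁻ ω, ((Finset.univ.sup fun i => X j (ω i) : NNReal) : ℝ≥0∞) ∂(Measure.pi G) :=
        Finset.sum_le_sum fun j _ =>
          mul_sum_lintegral_le_lintegral_sup G (fun _ => hX j) hD (hXpos j)
    _ ≤ ∫⁻ ω, ∑ j, ((Finset.univ.sup fun i => X j (ω i) : NNReal) : ℝ≥0∞) ∂(Measure.pi G) :=
        (lintegral_finsetSum _ fun j _ =>
          (measurable_finset_sup_eval _ fun _ => hX j).coe_nnreal_ennreal).ge
    _ ≤ ∫⁻ ω, ENNReal.ofReal (optWelfare (fun i => (ω i).1) Finset.univ Finset.univ)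
          ∂(Measure.pi G) := by
        refine lintegral_mono_ae ?_
        filter_upwards [hUD] with ω hω
        have := ENNReal.ofReal_le_ofReal (sum_sup_le_optWelfare hω fun i => (ω i).2)
        rw [ENNReal.ofReal_sum_of_nonneg fun j _ => NNReal.coe_nonneg _] at this
        simpa only [ENNReal.ofReal_coe_nnreal] using this
    _ = _ := hpi.lintegral_comp hmeas

end Favourites

/-! ### The number of copies -/

section Parameter

theorem two_div_le_two_pow_copiesParameter (n m : ℕ) :
    2 / ((1 - Real.exp (-1)) / max 1 ((n : ℝ) / m)) ≤ 2 ^ copiesParameter n m := by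
  have hD : (0 : ℝ) < max 1 ((n : ℝ) / m) := by positivity
  have he : 1 < Real.exp 1 := Real.one_lt_exp_iff.mpr one_pos
  have he' : 0 < Real.exp 1 - 1 := sub_pos.mpr he
  have heq : 2 / ((1 - Real.exp (-1)) / max 1 ((n : ℝ) / m)) =
      2 * Real.exp 1 / (Real.exp 1 - 1) * max 1 ((n : ℝ) / m) := by
    rw [Real.exp_neg]
    field_simp
  rw [heq, ← Real.rpow_natCast, ← Real.logb_le_iff_le_rpow one_lt_two (by positivity)]
  exact Nat.le_ceil _

/-- The number of choices for `ℓ` is of the order of the approximation factor. -/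
theorem copiesParameter_add_one_le (n m : ℕ) :
    (copiesParameter n m : ℝ) + 1 ≤ 6 * max 1 (Real.log ((n : ℝ) / m)) := by
  have hD : (0 : ℝ) < max 1 ((n : ℝ) / m) := by positivity
  have he := Real.exp_one_gt_d9
  have hc : 2 * Real.exp 1 / (Real.exp 1 - 1) ≤ 2 ^ 2 := by
    rw [div_le_iff₀ (by linarith)]
    linarith
  have hc1 : 1 ≤ 2 * Real.exp 1 / (Real.exp 1 - 1) := by
    rw [le_div_iff₀ (by linarith)]
    linarith
  have hc0 : 2 * Real.exp 1 / (Real.exp 1 - 1) ≠ 0 := by positivity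
  have hlog2 := Real.log_two_gt_d9
  have h1 : Real.logb 2 (2 * Real.exp 1 / (Real.exp 1 - 1)) ≤ 2 := by
    rw [Real.logb_le_iff_le_rpow one_lt_two (by positivity)]
    exact_mod_cast hc
  have h2 : Real.logb 2 (max 1 ((n : ℝ) / m)) ≤ 2 * max 1 (Real.log ((n : ℝ) / m)) := by
    rw [Real.logb, div_le_iff₀ (Real.log_pos one_lt_two)]
    have h3 : Real.log (max 1 ((n : ℝ) / m)) ≤ max 1 (Real.log ((n : ℝ) / m)) := by
      rcases max_cases 1 ((n : ℝ) / m) with h | h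
      · simp [h.1]
      · rw [h.1]
        exact le_max_right _ _
    have : 1 ≤ max 1 (Real.log ((n : ℝ) / m)) := le_max_left _ _
    nlinarith
  have h4 : 0 ≤ Real.logb 2 (2 * Real.exp 1 / (Real.exp 1 - 1) * max 1 ((n : ℝ) / m)) :=
    Real.logb_nonneg one_lt_two (one_le_mul_of_one_le_of_one_le hc1 (le_max_left _ _))
  have h5 := Nat.ceil_lt_add_one h4
  rw [Real.logb_mul hc0 hD.ne'] at h5
  have : 1 ≤ max 1 (Real.log ((n : ℝ) / m)) := le_max_left _ _
  rw [copiesParameter, Real.logb_mul hc0 hD.ne']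
  linarith

end Parameter

/-! ### The approximation guarantee -/

section Approximation

variable {N I : Type*} [Fintype N] [DecidableEq N] [Fintype I] [DecidableEq I]

/-- If the optimal welfare recovers in expectation a fraction `κ` of the sum of the agents' highest
values, and the largest number of copies is at least `2 / κ`, then the residual surplus recovers a
fraction `1 / (2 * (r + 1))` of the expected optimal welfare. -/
theorem lintegral_optWelfare_div_le (R : (ℓ : ℕ) → VCGRule N (I × Fin (2 ^ ℓ))) (r : ℕ)
    (F : N → Measure (Valuation I)) [∀ i, IsProbabilityMeasure (F i)]
    (hF : ∀ i, ∀ᵐ v ∂(F i), IsUnitDemand v) {κ : ℝ} (hκ : 0 < κ) (hr : 2 / κ ≤ 2 ^ r)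
    (hopt : ENNReal.ofReal κ * ∑ i, ∫⁻ v, ENNReal.ofReal (v Finset.univ) ∂(F i) ≤
      ∫⁻ v, ENNReal.ofReal (optWelfare v Finset.univ Finset.univ) ∂(Measure.pi F)) :
    (∫⁻ v, ENNReal.ofReal (optWelfare v Finset.univ Finset.univ) ∂(Measure.pi F)) /
        ENNReal.ofReal (2 * (r + 1)) ≤
      ∫⁻ v, ENNReal.ofReal (expect (vcgWithCopies R r v) (residualSurplus v))
        ∂(Measure.pi F) := by
  have hUD : ∀ᵐ v ∂(Measure.pi F), ∀ i, IsUnitDemand (v i) := by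
    rw [ae_all_iff]
    exact fun i => (measurePreserving_eval F i).quasiMeasurePreserving.ae (hF i)
  have hr1 : (0 : ℝ) < ((r : ℝ) + 1)⁻¹ := by positivity
  by_cases htop : ∃ i, ∫⁻ v, ENNReal.ofReal (v Finset.univ) ∂(F i) = ∞
  -- One agent has infinite expected value; her own utility already has infinite expectation.
  · obtain ⟨i, hi⟩ := htop
    have h := lintegral_sub_sum_erase_eq_top F (X := fun v : Valuation I => v Finset.univ)
      (by fun_prop) i hi
    refine le_trans le_top (le_trans (le_of_eq ?_) (lintegral_mono_ae (hUD.mono fun v hv =>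
      ENNReal.ofReal_le_ofReal (sub_sum_erase_le_expect_residualSurplus R r hv i))))
    simp only [ENNReal.ofReal_mul hr1.le]
    rw [lintegral_const_mul _ (by fun_prop), h, ENNReal.mul_top (by simpa using hr1)]
  · push Not at htop
    set E := ∫⁻ v, ENNReal.ofReal (optWelfare v Finset.univ Finset.univ) ∂(Measure.pi F)
    set S := ∑ i, ∫⁻ v, ENNReal.ofReal (v Finset.univ) ∂(F i) with hS
    have hSeq : ∫⁻ v, ENNReal.ofReal (∑ i, v i Finset.univ) ∂(Measure.pi F) = S := by
      rw [hS, lintegral_congr_ae (hUD.mono fun v hv => ENNReal.ofReal_sum_of_nonneg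
        fun i _ => (hv i).nonneg Finset.univ), lintegral_finsetSum _ fun i _ => by fun_prop]
      exact Finset.sum_congr rfl fun i _ => (measurePreserving_eval F i).lintegral_comp
        (f := fun v : Valuation I => ENNReal.ofReal (v Finset.univ)) (by fun_prop)
    have hE : E ≠ ∞ := by
      have hS' : S ≠ ∞ := ENNReal.sum_ne_top.mpr fun i _ => htop i
      refine ne_top_of_le_ne_top hS' ?_
      rw [← hSeq]
      exact lintegral_mono_ae (hUD.mono fun v hv => ENNReal.ofReal_le_ofReal
        (optWelfare_le_sum_univ (fun i => (hv i).toIsValuation) _ _))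
    set Y := ∫⁻ v, ENNReal.ofReal (optWelfare v Finset.univ Finset.univ -
      ((2 : ℝ) ^ r)⁻¹ * ∑ i, v i Finset.univ) ∂(Measure.pi F) with hY
    -- What is lost at the largest number of copies is at most half of the optimum.
    have hloss : ∫⁻ v, ENNReal.ofReal (((2 : ℝ) ^ r)⁻¹ * ∑ i, v i Finset.univ) ∂(Measure.pi F) ≤
        E / 2 := by
      have hκr : ((2 : ℝ) ^ r)⁻¹ ≤ κ / 2 := by
        rw [← inv_div]
        exact inv_anti₀ (by positivity) hr
      simp only [ENNReal.ofReal_mul (show (0 : ℝ) ≤ ((2 : ℝ) ^ r)⁻¹ by positivity)]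
      rw [lintegral_const_mul _ (by fun_prop), hSeq]
      calc ENNReal.ofReal ((2 : ℝ) ^ r)⁻¹ * S ≤ ENNReal.ofReal (κ / 2) * S := by gcongr
        _ = ENNReal.ofReal κ * S / 2 := by
          rw [ENNReal.ofReal_div_of_pos two_pos, ENNReal.ofReal_ofNat, ENNReal.mul_div_right_comm]
        _ ≤ E / 2 := by gcongr
    have hsplit : E ≤ Y + E / 2 := by
      refine le_trans ?_ (add_le_add_right hloss Y)
      rw [hY, ← lintegral_add_right _ (by fun_prop)]
      refine lintegral_mono fun v => ?_
      refine le_trans (le_of_eq ?_) ENNReal.ofReal_add_le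
      rw [sub_add_cancel]
    have hhalf : E / 2 ≤ Y := by
      refine ENNReal.le_of_add_le_add_right (a := E / 2) (ENNReal.div_ne_top hE two_ne_zero) ?_
      rwa [ENNReal.add_halves]
    calc E / ENNReal.ofReal (2 * (r + 1)) = ENNReal.ofReal ((r : ℝ) + 1)⁻¹ * (E / 2) := by
          rw [ENNReal.ofReal_mul two_pos.le, ENNReal.ofReal_ofNat, ENNReal.ofReal_inv_of_pos
            (by positivity), div_eq_mul_inv, div_eq_mul_inv, ENNReal.mul_inv (by simp) (by simp)]
          ring
      _ ≤ ENNReal.ofReal ((r : ℝ) + 1)⁻¹ * Y := by gcongr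
      _ ≤ ∫⁻ v, ENNReal.ofReal (((r : ℝ) + 1)⁻¹ * (optWelfare v Finset.univ Finset.univ -
            ((2 : ℝ) ^ r)⁻¹ * ∑ i, v i Finset.univ)) ∂(Measure.pi F) := by
          simp only [ENNReal.ofReal_mul hr1.le]
          exact lintegral_const_mul_le _ _
      _ ≤ _ := lintegral_mono_ae (hUD.mono fun v hv =>
          ENNReal.ofReal_le_ofReal (sub_le_expect_residualSurplus R r hv))

end Approximation

end Auction

theorem mainTheorem3 :
    ∃ C : ℝ, 1 ≤ C ∧
      ∀ (n m : ℕ), 0 < m →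
      ∀ (R : (ℓ : ℕ) → Auction.VCGRule (Fin n) (Fin m × Fin (2 ^ ℓ))),
        Auction.IsFeasible Auction.IsUnitDemand
          (Auction.vcgWithCopies R (Auction.copiesParameter n m)) ∧
        Auction.IsTruthfulInExpectation Auction.IsUnitDemand
          (Auction.vcgWithCopies R (Auction.copiesParameter n m)) ∧
        Auction.IsExPostIR Auction.IsUnitDemand
          (Auction.vcgWithCopies R (Auction.copiesParameter n m)) ∧
        ∀ F : Fin n → Measure (Auction.Valuation (Fin m)),
          (∀ i, IsProbabilityMeasure (F i)) →
          (∀ i, ∀ᵐ v ∂(F i), Auction.IsUnitDemand v) →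
          (∀ i, Auction.UniformHighestValue (F i)) →
          Auction.GuaranteesApprox
            (Auction.vcgWithCopies R (Auction.copiesParameter n m)) F
            (C * max 1 (Real.log ((n : ℝ) / m))) := by
  refine ⟨12, by norm_num, fun n m _ R => ⟨Auction.isFeasible_vcgWithCopies R _,
    Auction.isTruthfulInExpectation_vcgWithCopies R _, Auction.isExPostIR_vcgWithCopies R _,
    fun F hP hF hu => ?_⟩⟩
  have he : Real.exp (-1) < 1 := by simp
  have hκ : 0 < (1 - Real.exp (-1)) / max 1 ((n : ℝ) / m) :=
    div_pos (sub_pos.mpr he) (lt_max_of_lt_left one_pos)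
  have h := Auction.lintegral_optWelfare_div_le R (Auction.copiesParameter n m) F hF hκ
    (Auction.two_div_le_two_pow_copiesParameter n m)
    (Auction.mul_sum_lintegral_univ_le_lintegral_optWelfare F hF hu (le_max_left _ _)
      (by simp))
  refine le_trans (ENNReal.div_le_div_left (ENNReal.ofReal_le_ofReal ?_) _) h
  linarith [Auction.copiesParameter_add_one_le n m]
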